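/- For $b,d\in\mathbb N$ let $b^{\le d}$ be the set of strings of length at most $d$ over the alphabet $\{0,\dots,b-1\}$, partially ordered by the prefix relation $\preceq$. By a tree we mean a partially ordered set; a subtree of $T$ is any subset of $T$ with the induced order (not necessarily closed under predecessors), and $\mathrm{Leaves}(T)$ is the set of maximal elements of $T$. Write $[X]^2$ for the set of unordered pairs of distinct elements of $X$; for a coloring $f:[X]^2\to\{0,1\}$, a set $H\subseteq X$ is $f$-homogeneous if $f$ is constant on $[H]^2$. There is a primitive recursive function $B:\mathbb N^2\to\mathbb N$ such that for all $n,x\in\mathbb N$ with $n\ge 1$ the following holds. For every tree $(T,\preceq)\cong (B(n,x)^{\le 2n-1},\preceq)$ and every coloring $f:[\mathrm{Leaves}(T)]^2\to\{0,1\}$, there is a subtree $S\subseteq T$ such that $(S,\preceq)\cong (x^{\le n},\preceq)$, $\mathrm{Leaves}(S)\subseteq\mathrm{Leaves}(T)$, and $\mathrm{Leaves}(S)$ is $f$-homogeneous. -/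

import Mathlib

/-- The regular tree `b^{≤ d}`: all strings of length at most `d` over the alphabet
`{0, …, b - 1}`. (A structure rather than a subtype of lists, so that it does not inherit the
lexicographic order of lists.) -/
@[ext]
structure RegularTree (b d : ℕ) where
  path : List (Fin b)
  length_le : path.length ≤ d

/-- `b^{≤ d}` is ordered by the prefix relation on strings. -/
instance RegularTree.instPartialOrder (b d : ℕ) : PartialOrder (RegularTree b d) where
  le σ τ := σ.path <+: τ.path
  le_refl σ := List.prefix_refl σ.path
  le_trans _ _ _ h₁ h₂ := List.IsPrefix.trans h₁ h₂
  le_antisymm _ _ h₁ h₂ :=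
    RegularTree.ext (h₁.eq_of_length (Nat.le_antisymm h₁.length_le h₂.length_le))

/-- The leaves of a set `S` of nodes, viewed as a tree with the induced order: its maximal
elements. -/
def treeLeaves {α : Type*} [PartialOrder α] (S : Set α) : Set α :=
  {s | Maximal (fun t => t ∈ S) s}

/-- `[X]²`: the unordered pairs of distinct elements of `X`. -/
def unorderedPairs {α : Type*} (X : Set α) : Set (Finset α) :=
  {p | (p : Set α) ⊆ X ∧ p.card = 2}

/-- A set `H` is homogeneous for a coloring `f` of `[X]²` if `f` is constant on the pairs
contained in `H` (in use, `H ⊆ X`). -/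
def IsHomogeneousFor {α : Type*} {X : Set α} (f : unorderedPairs X → Fin 2) (H : Set α) : Prop :=
  ∃ c : Fin 2, ∀ p : unorderedPairs X, (p : Finset α) ∈ unorderedPairs H → f p = c

/-!
A set `A` of points of a partial order is called `b`-large of depth `d` above `r` (`IsLarge b d r A`)
if `A` contains the leaves of a copy of `b^{≤ d}` all of whose nodes are above `r`. This is
a recursive condition on `d`, and everything is proved by induction along it.

* Pigeonhole (`IsLarge.exists_color`): if `A` is `(k * b)`-large and coloured with `k` colours, then
  some colour class is `b`-large of the same depth.
* Ramsey for families of trees (`exists_cross_homogeneous`): from sufficiently many sufficiently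
  branching trees of depth `d`, one can select `p 0` or `p 1` trees and shrink each of them to
  a `b`-large tree of the same depth so that all pairs of leaves from *different* selected trees get
  the colour `0` or `1`, respectively. This is the Erdős–Szekeres induction on `p 0 + p 1`: one tree
  is cut down to a finite one, the leaves of all other trees are coloured by their colour patterns
  towards it, and pigeonhole is applied within each tree, then among the trees, and
  finally within the first tree.
* Main induction (`exists_homogeneous`): if `n 0 + n 1 ≤ d + 1`, then a sufficiently branching tree
  of depth `d` has, for some colour `c`, a `c`-homogeneous `x`-branching subtree of depth `n c`.
  By the previous point, the root may be assumed to have `x` children between which all pairs have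
  one colour `c`. In each child, the induction hypothesis applies with `n c` lowered by one.
  If it yields the other colour somewhere, that subtree will do. If it yields the colour `c`
  everywhere, the subtrees found are glued together below the root.

Taking `n 0 = n 1 = n` gives the depth `2 * n - 1`. The branching is obtained by one recursion along
the depth from a function built with powers and products, hence it is primitive recursive.
-/

/-! ### Large sets -/

/-- `IsLarge b d r A` says that `A` contains the leaves of a copy of `b^{≤ d}` with all nodes above
`r`. Distinct children `t i`, `t j` of a node have no common upper bound, so that nodes
above `t i` and nodes above `t j` are incomparable. -/
def IsLarge {P : Type*} [PartialOrder P] (b : ℕ) : ℕ → P → Set P → Prop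
  | 0, r, A => ∃ a ∈ A, r ≤ a
  | d + 1, r, A => ∃ s, r ≤ s ∧ ∃ t : Fin b → P, (∀ i, s < t i) ∧
      (∀ i j, i ≠ j → ∀ p, t i ≤ p → ¬ t j ≤ p) ∧ ∀ i, IsLarge b d (t i) A

section Large

variable {P : Type*} [PartialOrder P] {b d : ℕ} {r : P} {A : Set P}

theorem IsLarge.mono {A' : Set P} (h : IsLarge b d r A) (hA : A ⊆ A') : IsLarge b d r A' := by
  induction d generalizing r with
  | zero =>
    obtain ⟨a, ha, hr⟩ := h
    exact ⟨a, hA ha, hr⟩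
  | succ d ih =>
    obtain ⟨s, hs, t, h₁, h₂, h₃⟩ := h
    exact ⟨s, hs, t, h₁, h₂, fun i => ih (h₃ i)⟩

theorem IsLarge.mono_root {r' : P} (h : IsLarge b d r A) (hr : r' ≤ r) : IsLarge b d r' A := by
  cases d with
  | zero =>
    obtain ⟨a, ha, hra⟩ := h
    exact ⟨a, ha, hr.trans hra⟩
  | succ d =>
    obtain ⟨s, hs, h⟩ := h
    exact ⟨s, hr.trans hs, h⟩

theorem IsLarge.mono_branching {b' : ℕ} (h : IsLarge b d r A) (hb : b' ≤ b) :
    IsLarge b' d r A := by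
  induction d generalizing r with
  | zero => exact h
  | succ d ih =>
    obtain ⟨s, hs, t, h₁, h₂, h₃⟩ := h
    exact ⟨s, hs, fun i => t (Fin.castLE hb i), fun i => h₁ _,
      fun i j hij => h₂ _ _ (fun h => hij (Fin.castLE_injective hb h)), fun i => ih (h₃ _)⟩

theorem IsLarge.exists_mem (hb : 0 < b) (h : IsLarge b d r A) : ∃ a ∈ A, r ≤ a := by
  induction d generalizing r with
  | zero => exact h
  | succ d ih =>
    obtain ⟨s, hs, t, h₁, -, h₃⟩ := h
    obtain ⟨a, ha, hta⟩ := ih (h₃ ⟨0, hb⟩)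
    exact ⟨a, ha, hs.trans ((h₁ _).le.trans hta)⟩

/-- Pigeonhole for trees: some colour class contains the leaves of a subtree of the same depth whose
branching is divided by the number of colours. -/
theorem IsLarge.exists_color {κ : Type*} [Fintype κ] [Nonempty κ] (g : P → κ)
    (h : IsLarge (Fintype.card κ * b) d r A) : ∃ c, IsLarge b d r (A ∩ {a | g a = c}) := by
  classical
  induction d generalizing r with
  | zero =>
    obtain ⟨a, ha, hr⟩ := h
    exact ⟨g a, a, ⟨ha, rfl⟩, hr⟩
  | succ d ih =>
    obtain ⟨s, hs, t, h₁, h₂, h₃⟩ := h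
    choose c hc using fun i => ih (h₃ i)
    obtain ⟨c₀, hc₀⟩ := Fintype.exists_le_card_fiber_of_mul_le_card (n := b) c (by simp)
    obtain ⟨J, hJ, hJb⟩ := Finset.exists_subset_card_eq hc₀
    let e := (Finset.equivFinOfCardEq hJb).symm
    refine ⟨c₀, s, hs, fun i => t (e i), fun i => h₁ _,
      fun i j hij => h₂ _ _ (fun h => hij (e.injective (Subtype.ext h))), fun i => ?_⟩
    have : c (e i) = c₀ := (Finset.mem_filter.1 (hJ (e i).2)).2
    exact this ▸ hc (e i)

theorem IsLarge.exists_finset (h : IsLarge b d r A) :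
    ∃ F : Finset P, (F : Set P) ⊆ A ∧ F.card ≤ b ^ d ∧ IsLarge b d r (F : Set P) := by
  classical
  induction d generalizing r with
  | zero =>
    obtain ⟨a, ha, hr⟩ := h
    exact ⟨{a}, by simpa using ha, by simp, a, by simp, hr⟩
  | succ d ih =>
    obtain ⟨s, hs, t, h₁, h₂, h₃⟩ := h
    choose F hFA hF hFt using fun i => ih (h₃ i)
    refine ⟨Finset.univ.biUnion F, ?_, ?_, s, hs, t, h₁, h₂, fun i => (hFt i).mono ?_⟩
    · simpa using hFA
    · refine (Finset.card_biUnion_le_card_mul _ _ _ fun i _ => hF i).trans ?_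
      simp [pow_succ, mul_comm]
    · intro a ha
      simpa using ⟨i, ha⟩

end Large

/-! ### Ramsey's theorem for families of trees -/

/-- The number of trees, and at the same time their branching, from which `exists_cross_homogeneous`
selects `k 0` or `k 1` trees with branching `b`, where `k 0 + k 1 = k`; all trees have
depth `d`. -/
def crossBound (b d k : ℕ) : ℕ :=
  (2 ^ (2 * b) ^ d + 1) ^ k * (2 * b)

theorem two_mul_le_crossBound (b d k : ℕ) : 2 * b ≤ crossBound b d k :=
  Nat.le_mul_of_pos_left _ (by positivity)

theorem lt_crossBound_succ {b : ℕ} (hb : 0 < b) (d k : ℕ) :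
    2 ^ (2 * b) ^ d * crossBound b d k < crossBound b d (k + 1) := by
  have h : 0 < crossBound b d k := by unfold crossBound; positivity
  have : crossBound b d (k + 1) = 2 ^ (2 * b) ^ d * crossBound b d k + crossBound b d k := by
    unfold crossBound; ring
  omega

theorem exists_cross_homogeneous {P ι : Type*} [PartialOrder P] (f : P → P → Fin 2)
    (hf : ∀ u v, f u v = f v u) {b : ℕ} (hb : 0 < b) (d : ℕ) (t : ι → P) (k : ℕ)
    (p : Fin 2 → ℕ) (hp : p 0 + p 1 = k) (A : ι → Set P) (I : Finset ι)
    (hI : crossBound b d k ≤ I.card) (hA : ∀ i ∈ I, IsLarge (crossBound b d k) d (t i) (A i)) :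
    ∃ (c : Fin 2) (J : Finset ι) (A' : ι → Set P), J ⊆ I ∧ J.card = p c ∧
      (∀ i ∈ J, A' i ⊆ A i ∧ IsLarge b d (t i) (A' i)) ∧
      ∀ i ∈ J, ∀ j ∈ J, i ≠ j → ∀ u ∈ A' i, ∀ v ∈ A' j, f u v = c := by
  classical
  induction k generalizing p A I with
  | zero => exact ⟨0, ∅, A, by simp, by simp; omega, by simp, by simp⟩
  | succ k ih =>
    by_cases h0 : ∃ c, p c = 0
    · obtain ⟨c, hc⟩ := h0
      exact ⟨c, ∅, A, by simp, by simp [hc], by simp, by simp⟩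
    push Not at h0
    have hlt := lt_crossBound_succ hb d k
    obtain ⟨i₀, hi₀⟩ : I.Nonempty := Finset.card_pos.1 (by omega)
    -- The factor `2` is spent at the end, when the leaves of the tree at `i₀` are coloured with
    -- two colours.
    obtain ⟨F, hFA, hF, hFL⟩ :=
      ((hA i₀ hi₀).mono_branching (two_mul_le_crossBound b d (k + 1))).exists_finset
    have hcard : Fintype.card (F → Fin 2) ≤ 2 ^ (2 * b) ^ d := by
      simpa using Nat.pow_le_pow_right (by norm_num) hF
    have hmul : Fintype.card (F → Fin 2) * crossBound b d k ≤ 2 ^ (2 * b) ^ d * crossBound b d k :=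
      Nat.mul_le_mul_right _ hcard
    have hstep : ∀ i : ι, ∃ h : F → Fin 2, i ∈ I →
        IsLarge (crossBound b d k) d (t i) (A i ∩ {v | (fun u : F => f u v) = h}) := by
      intro i
      by_cases hi : i ∈ I
      · obtain ⟨h, hh⟩ := ((hA i hi).mono_branching (hmul.trans hlt.le)).exists_color
          (fun v => fun u : F => f u v)
        exact ⟨h, fun _ => hh⟩
      · exact ⟨fun _ => 0, fun h => (hi h).elim⟩
    choose h hh using hstep
    obtain ⟨h₀, -, hh₀⟩ := Finset.exists_le_card_fiber_of_mul_le_card_of_maps_to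
      (s := I.erase i₀) (t := Finset.univ) (f := h) (n := crossBound b d k) (by simp)
      Finset.univ_nonempty (by
        rw [Finset.card_erase_of_mem hi₀, Finset.card_univ]
        omega)
    obtain ⟨c₀, hc₀⟩ := IsLarge.exists_color (κ := Fin 2) (b := b)
      (fun u => if hu : u ∈ F then h₀ ⟨u, hu⟩ else 0) (by simpa using hFL)
    have hpc := h0 c₀
    obtain ⟨c, J, A', hJ, hJc, hA', hhom⟩ := ih (Function.update p c₀ (p c₀ - 1))
      (by fin_cases c₀ <;> simp at hpc ⊢ <;> omega)
      (fun i => A i ∩ {v | (fun u : F => f u v) = h i}) _ hh₀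
      (fun i hi => hh i (Finset.mem_of_mem_erase (Finset.mem_filter.1 hi).1))
    have hJI : ∀ i ∈ J, i ∈ I ∧ i ≠ i₀ ∧ h i = h₀ := fun i hi => by
      have := hJ hi
      simp only [Finset.mem_filter, Finset.mem_erase] at this
      exact ⟨this.1.2, this.1.1, this.2⟩
    by_cases hcc : c = c₀
    · subst hcc
      have hi₀J : i₀ ∉ J := fun hi => (hJI _ hi).2.1 rfl
      -- All pairs between the tree at `i₀` and the selected trees have colour `c`.
      have key : ∀ j ∈ J, ∀ u ∈ (F : Set P) ∩ {u | (if hu : u ∈ F then h₀ ⟨u, hu⟩ else 0) = c},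
          ∀ v ∈ A' j, f u v = c := by
        rintro j hj u ⟨huF, hu⟩ v hv
        have huF' : u ∈ F := huF
        have h1 := congrFun ((hA' j hj).1 hv).2 ⟨u, huF'⟩
        rw [(hJI j hj).2.2] at h1
        simpa [huF', ← h1] using hu
      refine ⟨c, insert i₀ J, Function.update A' i₀
        ((F : Set P) ∩ {u | (if hu : u ∈ F then h₀ ⟨u, hu⟩ else 0) = c}), ?_, ?_, ?_, ?_⟩
      · exact Finset.insert_subset hi₀ fun i hi => (hJI i hi).1
      · rw [Finset.card_insert_of_notMem hi₀J, hJc, Function.update_self]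
        omega
      · intro i hi
        rcases Finset.mem_insert.1 hi with rfl | hi
        · rw [Function.update_self]
          exact ⟨Set.inter_subset_left.trans hFA, hc₀⟩
        · rw [Function.update_of_ne (hJI i hi).2.1]
          exact ⟨(hA' i hi).1.trans Set.inter_subset_left, (hA' i hi).2⟩
      · intro i hi j hj hij
        rcases Finset.mem_insert.1 hi with rfl | hi' <;>
          rcases Finset.mem_insert.1 hj with rfl | hj'
        · exact (hij rfl).elim
        · rw [Function.update_self, Function.update_of_ne (hJI j hj').2.1]
          exact key j hj'
        · rw [Function.update_self, Function.update_of_ne (hJI i hi').2.1]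
          intro u hu v hv
          rw [hf]
          exact key i hi' v hv u hu
        · rw [Function.update_of_ne (hJI j hj').2.1, Function.update_of_ne (hJI i hi').2.1]
          exact hhom i hi' j hj' hij
    · refine ⟨c, J, A', fun i hi => (hJI i hi).1, ?_, fun i hi => ?_, hhom⟩
      · rwa [Function.update_of_ne hcc] at hJc
      · exact ⟨(hA' i hi).1.trans Set.inter_subset_left, (hA' i hi).2⟩

/-! ### Homogeneous subtrees -/

/-- The branching that suffices, at depth `d`, for homogeneous `x`-branching subtrees of depths
`n 0`, `n 1` with `n 0 + n 1 ≤ d + 1`. -/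
def branchingBound (x : ℕ) : ℕ → ℕ
  | 0 => 1
  | d + 1 => crossBound (branchingBound x d) d (2 * x)

theorem branchingBound_pos (x d : ℕ) : 0 < branchingBound x d := by
  induction d with
  | zero => exact Nat.one_pos
  | succ d ih =>
    have : 2 * branchingBound x d ≤ branchingBound x (d + 1) := two_mul_le_crossBound _ _ _
    omega

theorem exists_homogeneous {P : Type*} [PartialOrder P] (f : P → P → Fin 2)
    (hf : ∀ u v, f u v = f v u) (x d : ℕ) (n : Fin 2 → ℕ) (hn : n 0 + n 1 ≤ d + 1) (r : P)
    (A : Set P) (hA : IsLarge (branchingBound x d) d r A) :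
    ∃ c, ∃ A' ⊆ A, IsLarge x (n c) r A' ∧ ∀ u ∈ A', ∀ v ∈ A', u ≠ v → f u v = c := by
  classical
  induction d generalizing n r A with
  | zero =>
    obtain ⟨c, hc⟩ : ∃ c, n c = 0 := by
      by_cases h : n 0 = 0
      · exact ⟨0, h⟩
      · exact ⟨1, by omega⟩
    obtain ⟨a, ha, hr⟩ := hA
    exact ⟨c, {a}, by simpa using ha, hc ▸ ⟨a, rfl, hr⟩, by simp⟩
  | succ d ih =>
    by_cases h0 : ∃ c, n c = 0
    · obtain ⟨c, hc⟩ := h0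
      obtain ⟨a, ha, hr⟩ := hA.exists_mem (branchingBound_pos _ _)
      exact ⟨c, {a}, by simpa using ha, hc ▸ ⟨a, rfl, hr⟩, by simp⟩
    push Not at h0
    obtain ⟨s, hs, t, h₁, h₂, h₃⟩ := hA
    obtain ⟨c, J, A', -, hJ, hA', hcross⟩ := exists_cross_homogeneous f hf
      (branchingBound_pos x d) d t (2 * x) (fun _ => x) (by omega) (fun _ => A) Finset.univ
      (by rw [Finset.card_fin]; exact le_rfl) (fun i _ => h₃ i)
    have hnc := h0 c
    have hstep : ∀ i : J, ∃ c', ∃ A'' ⊆ A' i,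
        IsLarge x (Function.update n c (n c - 1) c') (t i) A'' ∧
          ∀ u ∈ A'', ∀ v ∈ A'', u ≠ v → f u v = c' := fun i =>
      ih _ (by fin_cases c <;> simp at hnc ⊢ <;> omega) _ _ (hA' i i.2).2
    choose c' A'' hA'' hlarge hhom using hstep
    by_cases hc : ∃ i, c' i ≠ c
    · obtain ⟨i, hi⟩ := hc
      refine ⟨c' i, A'' i, (hA'' i).trans (hA' i i.2).1, ?_, hhom i⟩
      have h := hlarge i
      rw [Function.update_of_ne hi] at h
      exact h.mono_root (hs.trans (h₁ i).le)
    · push Not at hc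
      let e := (Finset.equivFinOfCardEq hJ).symm
      refine ⟨c, ⋃ i, A'' i, Set.iUnion_subset fun i => (hA'' i).trans (hA' i i.2).1, ?_, ?_⟩
      · obtain ⟨m, hm⟩ := Nat.exists_eq_succ_of_ne_zero hnc
        rw [hm]
        refine ⟨s, hs, fun i => t (e i), fun i => h₁ _,
          fun i j hij => h₂ _ _ (fun h => hij (e.injective (Subtype.ext h))), fun i => ?_⟩
        have h := hlarge (e i)
        rw [hc, Function.update_self, hm] at h
        exact h.mono (Set.subset_iUnion _ _)
      · intro u hu v hv huv
        obtain ⟨i, hi⟩ := Set.mem_iUnion.1 hu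
        obtain ⟨j, hj⟩ := Set.mem_iUnion.1 hv
        by_cases hij : i = j
        · subst hij
          rw [← hc i]
          exact hhom i u hi v hj huv
        · exact hcross i i.2 j j.2 (fun h => hij (Subtype.ext h)) u (hA'' i hi) v (hA'' j hj)

/-! ### Large sets and regular trees -/

/-- The map on `x^{≤ n + 1}` that sends the root to `s` and is `e i` on the subtree above the
child `i` of the root. -/
def RegularTree.glue {P : Type*} {x n : ℕ} (s : P) (e : Fin x → RegularTree x n → P) :
    RegularTree x (n + 1) → P
  | ⟨[], _⟩ => s
  | ⟨i :: l, h⟩ => e i ⟨l, Nat.le_of_succ_le_succ h⟩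

theorem IsLarge.exists_orderEmbedding {P : Type*} [PartialOrder P] {x n : ℕ} {r : P} {A : Set P}
    (h : IsLarge x n r A) :
    ∃ e : RegularTree x n ↪o P, (∀ σ, r ≤ e σ) ∧ ∀ σ, σ.path.length = n → e σ ∈ A := by
  induction n generalizing r with
  | zero =>
    obtain ⟨a, ha, hr⟩ := h
    refine ⟨OrderEmbedding.ofMapLEIff (fun _ => a) fun σ τ => ?_, fun _ => hr, fun _ _ => ha⟩
    have hσ := List.length_eq_zero_iff.1 (Nat.le_zero.1 σ.length_le)
    simp only [le_refl, true_iff]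
    change σ.path <+: τ.path
    simp [hσ]
  | succ n ih =>
    obtain ⟨s, hs, t, h₁, h₂, h₃⟩ := h
    choose e het heA using fun i => ih (h₃ i)
    refine ⟨OrderEmbedding.ofMapLEIff (RegularTree.glue s fun i => e i) ?_, ?_, ?_⟩
    · rintro ⟨_ | ⟨i, l⟩, hl⟩ ⟨_ | ⟨j, m⟩, hm⟩
      · exact iff_of_true le_rfl le_rfl
      · exact iff_of_true ((h₁ j).le.trans (het j _)) List.nil_prefix
      · refine iff_of_false (fun h => ?_) (fun h => ?_)
        · exact ((h₁ i).trans_le (het i _)).not_ge h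
        · exact absurd (List.prefix_nil.1 h) (by simp)
      · change e i _ ≤ e j _ ↔ i :: l <+: j :: m
        rw [List.cons_prefix_cons]
        by_cases hij : i = j
        · subst hij
          rw [(e i).le_iff_le]
          simp only [true_and]
          rfl
        · refine iff_of_false (fun h => ?_) (fun h => hij h.1)
          exact h₂ i j hij _ ((het i _).trans h) (het j _)
    · rintro ⟨_ | ⟨i, l⟩, hl⟩
      · exact hs
      · exact hs.trans ((h₁ i).le.trans (het i _))
    · rintro ⟨_ | ⟨i, l⟩, hl⟩ hlen
      · simp at hlen
      · exact heA i _ (by simpa using hlen)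

theorem RegularTree.mem_treeLeaves_of_length_eq {b d : ℕ} {σ : RegularTree b d}
    (hσ : σ.path.length = d) : σ ∈ treeLeaves (Set.univ : Set (RegularTree b d)) :=
  ⟨trivial, fun τ _ h =>
    (RegularTree.ext (List.IsPrefix.eq_of_length_le h (τ.length_le.trans_eq hσ.symm)) : σ = τ).ge⟩

/-- For `x > 0` every string that is not of full length has a proper extension. -/
theorem RegularTree.length_eq_of_isMax {x n : ℕ} (hx : 0 < x) {σ : RegularTree x n}
    (hσ : IsMax σ) : σ.path.length = n := by
  by_contra hne
  have hlt := lt_of_le_of_ne σ.length_le hne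
  have h : (⟨σ.path ++ [⟨0, hx⟩], by simpa using hlt⟩ : RegularTree x n) ≤ σ :=
    hσ (List.prefix_append _ _)
  have := List.IsPrefix.length_le h
  simp at this

theorem RegularTree.isLarge_leaves {b d : ℕ} (k : ℕ) (σ : RegularTree b d)
    (hσ : σ.path.length + k = d) : IsLarge b k σ (treeLeaves Set.univ) := by
  induction k generalizing σ with
  | zero => exact ⟨σ, mem_treeLeaves_of_length_eq hσ, le_rfl⟩
  | succ k ih =>
    refine ⟨σ, le_rfl, fun i => ⟨σ.path ++ [i], by simp; omega⟩, fun i => ?_, ?_, fun i => ?_⟩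
    · refine lt_of_le_not_ge (List.prefix_append _ _) fun h => ?_
      have := List.IsPrefix.length_le h
      simp at this
    · intro i j hij τ hi hj
      have := (List.prefix_of_prefix_length_le hi hj (by simp)).eq_of_length (by simp)
      exact hij (by simpa using this)
    · exact ih _ (by simp; omega)

theorem IsLarge.map {P Q : Type*} [PartialOrder P] [PartialOrder Q] (φ : P ≃o Q) {b d : ℕ} {r : P}
    {A : Set P} (h : IsLarge b d r A) : IsLarge b d (φ r) (φ '' A) := by
  induction d generalizing r with
  | zero =>
    obtain ⟨a, ha, hr⟩ := h
    exact ⟨φ a, ⟨a, ha, rfl⟩, φ.monotone hr⟩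
  | succ d ih =>
    obtain ⟨s, hs, t, h₁, h₂, h₃⟩ := h
    refine ⟨φ s, φ.monotone hs, fun i => φ (t i), fun i => φ.strictMono (h₁ i),
      fun i j hij p hi hj => ?_, fun i => ih (h₃ i)⟩
    exact h₂ i j hij (φ.symm p) (φ.le_symm_apply.2 hi) (φ.le_symm_apply.2 hj)

theorem image_treeLeaves_univ_subset {P Q : Type*} [PartialOrder P] [PartialOrder Q] (φ : P ≃o Q) :
    φ '' treeLeaves Set.univ ⊆ treeLeaves Set.univ := by
  rintro _ ⟨a, ha, rfl⟩
  refine ⟨trivial, fun q _ h => ?_⟩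
  have := ha.2 (y := φ.symm q) trivial (φ.le_symm_apply.2 h)
  exact φ.symm_apply_le.1 this

theorem treeLeaves_range_subset {P : Type*} [PartialOrder P] {x n : ℕ} (hx : 0 < x)
    (e : RegularTree x n ↪o P) {A : Set P} (he : ∀ σ, σ.path.length = n → e σ ∈ A) :
    treeLeaves (Set.range e) ⊆ A := by
  rintro _ ⟨⟨σ, rfl⟩, hmax⟩
  exact he σ (RegularTree.length_eq_of_isMax hx fun τ h =>
    e.le_iff_le.1 (hmax ⟨τ, rfl⟩ (e.le_iff_le.2 h)))

/-! ### Primitive recursiveness of the bound -/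

theorem Primrec.nat_pow : Primrec₂ ((· ^ ·) : ℕ → ℕ → ℕ) :=
  Primrec₂.unpaired'.1 Nat.Primrec.pow

theorem primrec_crossBound {α : Type*} [Primcodable α] {b d k : α → ℕ} (hb : Primrec b)
    (hd : Primrec d) (hk : Primrec k) : Primrec fun a => crossBound (b a) (d a) (k a) := by
  have h2b := Primrec.nat_double.comp hb
  exact Primrec.nat_mul.comp (Primrec.nat_pow.comp (Primrec.succ.comp (Primrec.nat_pow.comp
    (Primrec.const 2) (Primrec.nat_pow.comp h2b hd))) hk) h2b

theorem primrec_branchingBound : Primrec₂ branchingBound := by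
  refine (Primrec.nat_rec (f := fun _ : ℕ => 1)
    (g := fun x (q : ℕ × ℕ) => crossBound q.2 q.1 (2 * x)) (Primrec.const 1) ?_).of_eq ?_
  · exact primrec_crossBound (Primrec.snd.comp Primrec.snd) (Primrec.fst.comp Primrec.snd)
      (Primrec.nat_double.comp Primrec.fst)
  · intro x d
    induction d with
    | zero => rfl
    | succ d ih => simp only [branchingBound, ← ih]

/-! ### Homogeneous copies of regular trees -/

theorem mainTheorem5 :
    ∃ B : ℕ → ℕ → ℕ, Primrec₂ B ∧
      ∀ n x : ℕ, 1 ≤ n →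
        ∀ (T : Type*) [PartialOrder T], Nonempty (T ≃o RegularTree (B n x) (2 * n - 1)) →
          ∀ f : unorderedPairs (treeLeaves (Set.univ : Set T)) → Fin 2,
            ∃ S : Set T,
              Nonempty (S ≃o RegularTree x n) ∧
              treeLeaves S ⊆ treeLeaves (Set.univ : Set T) ∧
              IsHomogeneousFor f (treeLeaves S) := by
  classical
  refine ⟨fun n x => branchingBound x (2 * n - 1), ?_, ?_⟩
  · exact primrec_branchingBound.comp Primrec.snd
      (Primrec.nat_sub.comp (Primrec.nat_double.comp Primrec.fst) (Primrec.const 1))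
  rintro n x hn T _ ⟨φ⟩ f
  -- The colouring, extended by the value `0` to all pairs of nodes.
  let g : T → T → Fin 2 := fun u v =>
    if h : ({u, v} : Finset T) ∈ unorderedPairs (treeLeaves (Set.univ : Set T)) then f ⟨_, h⟩ else 0
  have hg : ∀ u v, g u v = g v u := fun u v => by
    simp only [g, Finset.pair_comm u v]
  have hlarge := ((RegularTree.isLarge_leaves (2 * n - 1)
    (⟨[], Nat.zero_le _⟩ : RegularTree (branchingBound x (2 * n - 1)) (2 * n - 1))
    (by simp)).map φ.symm).mono (image_treeLeaves_univ_subset φ.symm)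
  obtain ⟨c, A, hAT, hA, hhom⟩ :=
    exists_homogeneous g hg x _ (fun _ => n) (by omega) _ _ hlarge
  -- A set all of whose leaves lie in `A` is as required.
  have key : ∀ S : Set T, treeLeaves S ⊆ A → treeLeaves S ⊆ treeLeaves (Set.univ : Set T) ∧
      IsHomogeneousFor f (treeLeaves S) := by
    refine fun S hS => ⟨hS.trans hAT, c, ?_⟩
    rintro ⟨p, hp⟩ ⟨hpS, hp2⟩
    obtain ⟨u, v, huv, rfl⟩ := Finset.card_eq_two.1 hp2
    have h := hhom u (hS (hpS (by simp))) v (hS (hpS (by simp))) huv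
    simpa only [g, dif_pos hp] using h
  rcases Nat.eq_zero_or_pos x with rfl | hx
  · -- `0^{≤ n}` is a single point, but its string is not of length `n`: any leaf of `T` will do.
    obtain ⟨a, ha, -⟩ := hlarge.exists_mem (branchingBound_pos _ _)
    have hsub : treeLeaves ({a} : Set T) ⊆ {a} := fun b hb => hb.1
    let _ : Unique (RegularTree 0 n) :=
      ⟨⟨⟨[], Nat.zero_le _⟩⟩, fun σ => RegularTree.ext (Subsingleton.elim _ _)⟩
    refine ⟨{a}, ⟨OrderIso.ofUnique _ _⟩, hsub.trans (by simpa using ha), 0, ?_⟩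
    rintro p ⟨hp, hp2⟩
    have := Finset.card_le_card (Finset.coe_subset.1
      ((hp.trans hsub).trans_eq (Finset.coe_singleton a).symm))
    rw [hp2, Finset.card_singleton] at this
    omega
  · obtain ⟨e, -, he⟩ := hA.exists_orderEmbedding
    exact ⟨Set.range e, ⟨e.orderIso.symm⟩, key _ (treeLeaves_range_subset hx e he)⟩
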